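/- Consider a synchronous (lock-step round-based) system of $n$ processes $p_1,\dots,p_n$ on the complete graph with reliable point-to-point channels, of which a set $F$ of at most $f$ processes is Byzantine faulty (they may behave arbitrarily); process $p_i$ has an input $x_i\in\mathbb{R}^d$. A deterministic algorithm solves \emph{exact Byzantine vector consensus} (exact BVC) if, for every $F$ with $|F|\le f$, all inputs and every behaviour of the faulty processes: (agreement) the decision vectors of all non-faulty processes are identical; (validity) the decision vector of each non-faulty process is in the convex hull of the inputs of the non-faulty processes; (termination) each non-faulty process terminates after finitely many rounds. For a multiset $Y$ of points of $\mathbb{R}^d$, let $\Gamma(Y)=\bigcap_{T\subseteq Y,\ |T|=|Y|-f}\mathcal{H}(T)$, where $\mathcal{H}$ denotes the convex hull. A \emph{scalar Byzantine broadcast protocol} with designated sender $p_s$, whose input is a real number, is a protocol in which, for every $F$ with $|F|\le f$ and every behaviour of the faulty processes, every non-faulty process terminates after finitely many rounds, all non-faulty processes decide on the same real number, and this number is the sender's input if the sender is non-faulty. \textbf{Theorem.} Suppose $n\ge\max(3f+1,(d+1)f+1)$. Then exact BVC can be solved in the presence of up to $f$ Byzantine faults. More precisely: (1) There is a scalar Byzantine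 broadcast protocol for every sender, and there is a function $g$ that maps every multiset $Y$ of $n$ points of $\mathbb{R}^d$ to a point $g(Y)\in\Gamma(Y)$ (in particular, $\Gamma(Y)\neq\emptyset$). (2) For any such broadcast protocols and any such function $g$, the following algorithm solves exact BVC: every process broadcasts each coordinate of its input by the broadcast protocol, and a process that has terminated in all the broadcasts decides $g(S)$, where $S$ is the multiset of the $n$ vectors it has obtained. In every execution with at most $f$ faulty processes, all non-faulty processes obtain the same $n$ vectors, among which the vector obtained from each non-faulty process is its input; hence they hold the same multiset $S$ and decide $g(S)$; moreover, $\Gamma(S)$ is non-empty and is contained in the convex hull of the inputs of the non-faulty processes. -/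

import Mathlib

/-- Points of `d`-dimensional real space. -/
abbrev Pt (d : ℕ) : Type := EuclideanSpace ℝ (Fin d)

/-- A deterministic synchronous round-based message-passing protocol for `n` processes on the
complete graph, with inputs in `I` and decisions in `O`. Process `i` starts in `init i x`, where
`x` is its own input. In every round a process `i` in local state `s` sends `send i s j` to each
process `j` (`none` means no message), and then moves to `step i s inbox`, where `inbox j` is what
it got from `j` in that round. A process has decided `v` and terminated once it is in a state `s`
with `output i s = some v`. The functions may depend on the identity of the process, but a process
sees nothing but its own input and the messages delivered to it. -/
structure SyncProtocol (n : ℕ) (I O : Type) where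
  State : Type
  Msg : Type
  init : Fin n → I → State
  send : Fin n → State → Fin n → Option Msg
  step : Fin n → State → (Fin n → Option Msg) → State
  output : Fin n → State → Option O

namespace SyncProtocol

variable {n : ℕ} {I O : Type}

/-- What process `i` in state `s` really sends to `j`: a terminated process sends nothing. -/
def emit (P : SyncProtocol n I O) (i : Fin n) (s : P.State) (j : Fin n) : Option P.Msg :=
  if (P.output i s).isSome then none else P.send i s j

/-- The state after one round: a terminated process no longer changes its state. -/
def next (P : SyncProtocol n I O) (i : Fin n) (s : P.State) (inbox : Fin n → Option P.Msg) :
    P.State :=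
  if (P.output i s).isSome then s else P.step i s inbox

/-- A Byzantine behaviour: `adv t j i` is what `j`, if it is faulty, sends to `i` in round `t`.
There is no restriction on it; a faulty process may tell different things to different processes. -/
abbrev Adversary (P : SyncProtocol n I O) : Type := ℕ → Fin n → Fin n → Option P.Msg

/-- `P.run F x adv t i` is the local state of the process `i` after `t` rounds of the execution with
set `F` of faulty processes, inputs `x` and Byzantine behaviour `adv`. (For `i ∈ F` it is
meaningless, and nobody else depends on it.) -/
def run (P : SyncProtocol n I O) (F : Finset (Fin n)) (x : Fin n → I) (adv : P.Adversary) :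
    ℕ → Fin n → P.State
  | 0, i => P.init i (x i)
  | t + 1, i => P.next i (P.run F x adv t i)
      (fun j => if j ∈ F then adv t j i else P.emit j (P.run F x adv t j) i)

/-- In the given execution, process `i` terminates after finitely many rounds with decision `v`. -/
def Decides (P : SyncProtocol n I O) (F : Finset (Fin n)) (x : Fin n → I) (adv : P.Adversary)
    (i : Fin n) (v : O) : Prop :=
  ∃ t, P.output i (P.run F x adv t i) = some v

end SyncProtocol

/-- `P` solves exact Byzantine vector consensus in the presence of up to `f` Byzantine faults. -/
structure SolvesExactBVC {n d : ℕ} (P : SyncProtocol n (Pt d) (Pt d)) (f : ℕ) : Prop where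
  agreement : ∀ (F : Finset (Fin n)), F.card ≤ f → ∀ (x : Fin n → Pt d) (adv : P.Adversary),
    ∀ i ∉ F, ∀ j ∉ F, ∀ u v : Pt d, P.Decides F x adv i u → P.Decides F x adv j v → u = v
  validity : ∀ (F : Finset (Fin n)), F.card ≤ f → ∀ (x : Fin n → Pt d) (adv : P.Adversary),
    ∀ i ∉ F, ∀ v : Pt d, P.Decides F x adv i v → v ∈ convexHull ℝ (x '' {j | j ∉ F})
  termination : ∀ (F : Finset (Fin n)), F.card ≤ f → ∀ (x : Fin n → Pt d) (adv : P.Adversary),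
    ∀ i ∉ F, ∃ v : Pt d, P.Decides F x adv i v

/-- The inputs of a broadcast: the sender `s` has the value `v`, the others have no input. -/
def senderInput {n : ℕ} (s : Fin n) (v : ℝ) (i : Fin n) : Option ℝ :=
  if i = s then some v else none

/-- `P` is a scalar Byzantine broadcast protocol with designated sender `s` that tolerates up to `f`
Byzantine faults. -/
structure IsByzantineBroadcast {n : ℕ} (P : SyncProtocol n (Option ℝ) ℝ) (s : Fin n) (f : ℕ) :
    Prop where
  agreement : ∀ (F : Finset (Fin n)), F.card ≤ f → ∀ (v : ℝ) (adv : P.Adversary),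
    ∀ i ∉ F, ∀ j ∉ F, ∀ a b : ℝ, P.Decides F (senderInput s v) adv i a →
      P.Decides F (senderInput s v) adv j b → a = b
  validity : ∀ (F : Finset (Fin n)), F.card ≤ f → ∀ (v : ℝ) (adv : P.Adversary), s ∉ F →
    ∀ i ∉ F, ∀ a : ℝ, P.Decides F (senderInput s v) adv i a → a = v
  termination : ∀ (F : Finset (Fin n)), F.card ≤ f → ∀ (v : ℝ) (adv : P.Adversary),
    ∀ i ∉ F, ∃ a : ℝ, P.Decides F (senderInput s v) adv i a

/-- The multiset of the `n` points of a family. -/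
def pointMultiset {n d : ℕ} (S : Fin n → Pt d) : Multiset (Pt d) :=
  Finset.univ.val.map S

/-- `Γ(Y)`: the intersection of the convex hulls of all submultisets of `Y` of size `|Y| - f`. -/
def Gam {d : ℕ} (f : ℕ) (Y : Multiset (Pt d)) : Set (Pt d) :=
  {z | ∀ T : Multiset (Pt d), T ≤ Y → T.card = Y.card - f → z ∈ convexHull ℝ {y | y ∈ T}}

/-- The vectors that process `i` has put together: its state `σ` holds, for every sender `s` and
every coordinate `k`, a local state of the broadcast by `s` of the `k`-th coordinate of its input;
there is a result once `i` has terminated in all these broadcasts. -/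
def collected {n d : ℕ} (B : Fin n → SyncProtocol n (Option ℝ) ℝ) (i : Fin n)
    (σ : (s : Fin n) → Fin d → (B s).State) : Option (Fin n → Pt d) :=
  if h : ∀ s k, ((B s).output i (σ s k)).isSome then
    some (fun s => WithLp.toLp 2 (fun k => ((B s).output i (σ s k)).get (h s k)))
  else none

/-- The exact BVC algorithm built from broadcast protocols `B s` (one for every sender `s`) and a
deterministic function `pick`. All the `n * d` broadcasts (of each coordinate of each input) run
in parallel; a process that has terminated in all of them decides on `pick` of the multiset of the
`n` vectors that it has received. -/
abbrev bvcAlgorithm {n d : ℕ} (B : Fin n → SyncProtocol n (Option ℝ) ℝ)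
    (pick : Multiset (Pt d) → Pt d) : SyncProtocol n (Pt d) (Pt d) where
  State := (s : Fin n) → Fin d → (B s).State
  Msg := (s : Fin n) → Fin d → Option (B s).Msg
  init i x := fun s k => (B s).init i (senderInput s (x k) i)
  send i σ j := some (fun s k => (B s).emit i (σ s k) j)
  step i σ inbox := fun s k =>
    (B s).next i (σ s k) (fun j => (inbox j).bind (fun m => m s k))
  output i σ := (collected B i σ).map (fun S => pick (pointMultiset S))

/-!
The points of `Γ(Y)` come from Helly's theorem (`Gam_nonempty`), which is where `n ≥ (d + 1) * f + 1` is
used. That `Γ(S)` lies in the convex hull of the non-faulty inputs is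
immediate: `S` contains `n - f` non-faulty inputs, and their convex hull is one of the sets that are
intersected in `Γ(S)`.

The bound `3 * f + 1` is what Byzantine broadcast needs. It is obtained here from a king protocol in
the style of Berman, Garay and Perry, for real values (`kingProtocol`): there are `f + 1` leader
rounds with different leaders, the first of them the sender, and two rounds between consecutive
leader rounds in which the processes exchange their values and then the values that `n - f`
processes have reported. Non-faulty processes cannot propose different values (`eq_of_le_votes`),
and a process that sees `n - f` equal proposals can be sure that all the others have taken over this
value, so that it need not listen to the next leader (`kingRun_val_eq_of_sure`). Hence a non-faulty
leader makes the non-faulty processes agree (`kingRun_val_of_leader`), later leaders cannot destroy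
the agreement (`kingRun_val_persists`), and among `f + 1` leaders one is not faulty. If the sender is
not faulty, the agreement is on its input from the start.

Finally, each of the `n * d` broadcasts that the consensus algorithm runs in parallel is, round for
round, an execution of the broadcast protocol on its own, against the adversary that is read off
from the components of the faulty messages (`bvcAlgorithm_run`). Agreement and validity of the
broadcasts therefore say that all the non-faulty processes collect the same vectors, the inputs of
the non-faulty processes among them (`bvcAlgorithm_collects`).
-/

/-! ### The safe area `Γ` -/

open Finset in
/-- Helly's theorem gives a point of `Γ(Y)`: the `d + 1` multisets left out by `d + 1` of the
submultisets `T` have at most `(d + 1) * f < |Y|` points in all, so some point of `Y` belongs to all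
of these `T`. -/
theorem Gam_nonempty {d f : ℕ} (Y : Multiset (Pt d)) (hY : (d + 1) * f + 1 ≤ Y.card) :
    (Gam f Y).Nonempty := by
  classical
  have key : (⋂ T ∈ (Multiset.powersetCard (Y.card - f) Y).toFinset,
      convexHull ℝ {y : Pt d | y ∈ T}).Nonempty := by
    refine Convex.helly_theorem' (fun T _ => convex_convexHull ℝ _) ?_
    intro I hI hcard
    rw [finrank_euclideanSpace_fin] at hcard
    have hT : ∀ T ∈ I, T ≤ Y ∧ T.card = Y.card - f := fun T hTI => by
      simpa [Multiset.mem_powersetCard] using hI hTI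
    have hlt : (∑ T ∈ I, (Y - T)).card < Y.card := by
      rw [Multiset.card_sum]
      calc ∑ T ∈ I, (Y - T).card ≤ ∑ _T ∈ I, f := by
            refine sum_le_sum fun T hTI => ?_
            rw [Multiset.card_sub (hT T hTI).1, (hT T hTI).2]
            omega
        _ ≤ (d + 1) * f := by
            rw [sum_const, smul_eq_mul]
            exact Nat.mul_le_mul_right _ hcard
        _ < Y.card := hY
    have hnot : ¬ Y ≤ ∑ T ∈ I, (Y - T) := fun h =>
      absurd (Multiset.card_le_card h) (not_le.2 hlt)
    rw [Multiset.le_iff_count] at hnot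
    push Not at hnot
    obtain ⟨y, hy⟩ := hnot
    refine ⟨y, Set.mem_iInter₂.2 fun T hTI => subset_convexHull ℝ _ ?_⟩
    rw [Multiset.count_sum'] at hy
    have h1 : Multiset.count y (Y - T) ≤ ∑ T ∈ I, Multiset.count y (Y - T) :=
      single_le_sum (f := fun T => Multiset.count y (Y - T)) (fun _ _ => Nat.zero_le _) hTI
    rw [Multiset.count_sub] at h1
    exact Multiset.count_pos.1 (by omega)
  obtain ⟨z, hz⟩ := key
  refine ⟨z, fun T hT hc => Set.mem_iInter₂.1 hz T ?_⟩
  simpa [Multiset.mem_powersetCard] using ⟨hT, hc⟩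

theorem Gam_pointMultiset_subset {n d f : ℕ} (F : Finset (Fin n)) (hF : F.card ≤ f)
    (S x : Fin n → Pt d) (hS : ∀ i ∉ F, S i = x i) :
    Gam f (pointMultiset S) ⊆ convexHull ℝ (x '' {j | j ∉ F}) := by
  intro z hz
  have hc : n - f ≤ Fᶜ.card := by
    rw [Finset.card_compl, Fintype.card_fin]
    omega
  obtain ⟨G, hG, hGc⟩ := Finset.exists_subset_card_eq hc
  refine convexHull_mono ?_ (hz (G.val.map S)
    (Multiset.map_le_map (Finset.val_le_iff.2 (Finset.subset_univ G))) ?_)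
  · rintro y hy
    obtain ⟨i, hi, rfl⟩ := Multiset.mem_map.1 hy
    have hiF : i ∉ F := by simpa using hG hi
    exact ⟨i, hiF, (hS i hiF).symm⟩
  · simpa [pointMultiset] using hGc

/-! ### Decisions are final -/

namespace SyncProtocol

variable {n : ℕ} {I O : Type} (P : SyncProtocol n I O) (F : Finset (Fin n)) (x : Fin n → I)
  (adv : P.Adversary)

theorem run_of_terminated {i : Fin n} {t : ℕ} (h : (P.output i (P.run F x adv t i)).isSome)
    {t' : ℕ} (ht : t ≤ t') : P.run F x adv t' i = P.run F x adv t i := by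
  induction t', ht using Nat.le_induction with
  | base => rfl
  | succ m _ ih => rw [run, next, ih, if_pos h]

theorem Decides.unique {P : SyncProtocol n I O} {F : Finset (Fin n)} {x : Fin n → I}
    {adv : P.Adversary} {i : Fin n} {u v : O} (hu : P.Decides F x adv i u)
    (hv : P.Decides F x adv i v) : u = v := by
  obtain ⟨t, ht⟩ := hu
  obtain ⟨t', ht'⟩ := hv
  have h1 := P.run_of_terminated F x adv (by rw [ht]; rfl) (le_max_left t t')
  have h2 := P.run_of_terminated F x adv (by rw [ht']; rfl) (le_max_right t t')
  rw [← h1] at ht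
  rw [← h2] at ht'
  exact Option.some.inj (ht.symm.trans ht')

end SyncProtocol

/-! ### Counting messages -/

section King

variable {n : ℕ}

/-- The number of processes from which the value `y` was received. -/
noncomputable def votes (inbox : Fin n → Option ℝ) (y : ℝ) : ℕ :=
  (Finset.univ.filter fun j => inbox j = some y).card

open Classical in
/-- Some value that was received from at least `q` processes, if there is one. -/
noncomputable def popular (inbox : Fin n → Option ℝ) (q : ℕ) : Option ℝ :=
  if h : ∃ y, q ≤ votes inbox y then some h.choose else none

theorem le_votes_of_popular {inbox : Fin n → Option ℝ} {q : ℕ} {y : ℝ}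
    (h : popular inbox q = some y) : q ≤ votes inbox y := by
  unfold popular at h
  split_ifs at h with hq
  exact Option.some.inj h ▸ hq.choose_spec

theorem exists_popular {inbox : Fin n → Option ℝ} {q : ℕ} {y : ℝ} (h : q ≤ votes inbox y) :
    ∃ z, popular inbox q = some z :=
  ⟨_, dif_pos ⟨y, h⟩⟩

/-- What a process receives in a round in which every process `j ∉ F` sends `m j` to everybody and
the faulty processes send it the messages `a`. -/
def mixed (F : Finset (Fin n)) (m a : Fin n → Option ℝ) (j : Fin n) : Option ℝ :=
  if j ∈ F then a j else m j

theorem mixed_of_notMem {F : Finset (Fin n)} {j : Fin n} (hj : j ∉ F) (m a : Fin n → Option ℝ) :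
    mixed F m a j = m j :=
  if_neg hj

/-- The number of non-faulty processes among those that send `y`. -/
noncomputable def honestVotes (F : Finset (Fin n)) (m : Fin n → Option ℝ) (y : ℝ) : ℕ :=
  (Finset.univ.filter fun j => j ∉ F ∧ m j = some y).card

variable {F : Finset (Fin n)} {m : Fin n → Option ℝ} {f : ℕ}

theorem honestVotes_le_votes (a : Fin n → Option ℝ) (y : ℝ) :
    honestVotes F m y ≤ votes (mixed F m a) y := by
  refine Finset.card_le_card fun j hj => ?_
  simp only [Finset.mem_filter, Finset.mem_univ, true_and] at hj ⊢
  rw [mixed_of_notMem hj.1, hj.2]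

theorem votes_le (hF : F.card ≤ f) (a : Fin n → Option ℝ) (y : ℝ) :
    votes (mixed F m a) y ≤ honestVotes F m y + f := by
  refine le_trans (Finset.card_le_card (t := (Finset.univ.filter fun j => j ∉ F ∧ m j = some y) ∪ F)
    fun j hj => ?_) ((Finset.card_union_le _ _).trans (Nat.add_le_add_left hF _))
  simp only [Finset.mem_filter, Finset.mem_univ, true_and, Finset.mem_union] at hj ⊢
  by_cases h : j ∈ F
  · exact Or.inr h
  · exact Or.inl ⟨h, (mixed_of_notMem h m a).symm.trans hj⟩

theorem exists_sender_of_lt_votes (hF : F.card ≤ f) {a : Fin n → Option ℝ} {y : ℝ}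
    (h : f < votes (mixed F m a) y) : ∃ j ∉ F, m j = some y := by
  have := votes_le (m := m) hF a y
  obtain ⟨j, hj⟩ := Finset.card_pos.1 (show 0 < honestVotes F m y by omega)
  simp only [Finset.mem_filter, Finset.mem_univ, true_and] at hj
  exact ⟨j, hj⟩

theorem le_votes_of_unanimous (hF : F.card ≤ f) {y : ℝ} (h : ∀ j ∉ F, m j = some y)
    (a : Fin n → Option ℝ) : n - f ≤ votes (mixed F m a) y := by
  refine le_trans ?_ (honestVotes_le_votes a y)
  calc n - f ≤ Fᶜ.card := by
        rw [Finset.card_compl, Fintype.card_fin]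
        omega
    _ ≤ _ := Finset.card_le_card fun j hj => by
        have : j ∉ F := by simpa using hj
        simpa using ⟨this, h j this⟩

/-- A value that one process receives from `n - f` processes is received by everybody from more
than `f` processes. -/
theorem lt_votes_of_le_votes (hn : 3 * f + 1 ≤ n) (hF : F.card ≤ f) {a : Fin n → Option ℝ} {y : ℝ}
    (h : n - f ≤ votes (mixed F m a) y) (b : Fin n → Option ℝ) :
    f < votes (mixed F m b) y := by
  have := votes_le (m := m) hF a y
  have := honestVotes_le_votes (F := F) (m := m) b y
  omega

/-- No two values can each be received from `n - f` processes, not even by two different processes: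
at least `n - f - |F|` non-faulty processes would have sent each of them, and there are only
`n - |F| < 2 * (n - f - |F|)` non-faulty processes. -/
theorem eq_of_le_votes (hn : 3 * f + 1 ≤ n) (hF : F.card ≤ f) {a b : Fin n → Option ℝ} {y z : ℝ}
    (hy : n - f ≤ votes (mixed F m a) y) (hz : n - f ≤ votes (mixed F m b) z) : y = z := by
  by_contra hne
  have h1 := votes_le (m := m) le_rfl a y (F := F)
  have h2 := votes_le (m := m) le_rfl b z (F := F)
  have h3 : honestVotes F m y + honestVotes F m z ≤ Fᶜ.card := by
    unfold honestVotes
    rw [← Finset.card_union_of_disjoint]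
    · refine Finset.card_le_card fun j hj => ?_
      simp only [Finset.mem_union, Finset.mem_filter, Finset.mem_univ, true_and] at hj
      simpa using hj.elim And.left And.left
    · refine Finset.disjoint_left.2 fun j hj hj' => hne ?_
      simp only [Finset.mem_filter, Finset.mem_univ, true_and] at hj hj'
      exact Option.some.inj (hj.2.symm.trans hj'.2)
  rw [Finset.card_compl, Fintype.card_fin] at h3
  omega

/-! ### Byzantine broadcast by a king protocol -/

/-- Local state of the king protocol: the number of the current round, the current value, the value
that the process proposes, and whether it is sure enough of its value to ignore the leader. -/
structure KingState where
  round : ℕ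
  val : ℝ
  prop : Option ℝ
  sure : Prop

/-- The leader of the `k`-th leader round; the sender `s` is the first one. -/
def leader (s : Fin n) (k : ℕ) : Fin n :=
  ⟨(s + k) % n, Nat.mod_lt _ s.pos⟩

theorem leader_zero (s : Fin n) : leader s 0 = s :=
  Fin.ext (Nat.mod_eq_of_lt s.isLt)

/-- There are `f + 1` different leaders, so one of them is not faulty. -/
theorem exists_leader_notMem (hn : f < n) (hF : F.card ≤ f) (s : Fin n) :
    ∃ k ≤ f, leader s k ∉ F := by
  by_contra! h
  have hinj : Set.InjOn (leader s) (Finset.range (f + 1) : Set ℕ) := by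
    intro k hk l hl hkl
    simp only [Finset.coe_range, Set.mem_Iio] at hk hl
    have : s + k ≡ s + l [MOD n] := Fin.val_eq_of_eq hkl
    exact (Nat.ModEq.add_left_cancel' _ this).eq_of_lt_of_lt (by omega) (by omega)
  have hle := Finset.card_le_card (Finset.image_subset_iff.2 fun k hk =>
    h k (Nat.lt_succ_iff.1 (Finset.mem_range.1 hk)))
  rw [Finset.card_image_of_injOn hinj, Finset.card_range] at hle
  omega

/-- What a process tells everybody: its proposal in the rounds `2, 5, 8, …`, its value otherwise. -/
noncomputable def KingState.message (st : KingState) : Option ℝ :=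
  if st.round % 3 = 2 then st.prop else some st.val

open Classical in
/-- One round of the king protocol. In a leader round (`0, 3, 6, …`) the processes that are not sure
adopt the value of the leader. In the next round they tell each other their values, and propose a
value that has been received from `n - f` processes. In the third one they tell each other their
proposals, adopt a value that has been proposed by more than `f` processes, and are sure of their
value if `n - f` processes have proposed it. -/
noncomputable def KingState.step (f : ℕ) (s : Fin n) (st : KingState) (inbox : Fin n → Option ℝ) :
    KingState where
  round := st.round + 1
  val :=
    if st.round % 3 = 0 then
      if st.sure then st.val else (inbox (leader s (st.round / 3))).getD 0
    else if st.round % 3 = 1 then st.val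
    else (popular inbox (f + 1)).getD st.val
  prop := if st.round % 3 = 1 then popular inbox (n - f) else st.prop
  sure :=
    if st.round % 3 = 2 then n - f ≤ votes inbox ((popular inbox (f + 1)).getD st.val)
    else st.sure

/-- The king protocol as a broadcast protocol with sender `s`: `f + 1` leader rounds, between which
there are `f` exchanges of values and proposals. -/
noncomputable def kingProtocol (n f : ℕ) (s : Fin n) : SyncProtocol n (Option ℝ) ℝ where
  State := KingState
  Msg := ℝ
  init _ x := ⟨0, x.getD 0, none, False⟩
  send _ st _ := st.message
  step _ st inbox := st.step f s inbox
  output _ st := if 3 * f + 1 ≤ st.round then some st.val else none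

section Execution

variable (s : Fin n) (F : Finset (Fin n)) (x : Fin n → Option ℝ)
  (adv : (kingProtocol n f s).Adversary)

/-- The state of a process of the king protocol after `t` rounds. -/
noncomputable def kingRun (t : ℕ) (i : Fin n) : KingState :=
  (kingProtocol n f s).run F x adv t i

/-- The messages that a process gets in round `t` of the king protocol. -/
noncomputable def kingInbox (t : ℕ) (i : Fin n) : Fin n → Option ℝ :=
  mixed F (fun j => (kingRun s F x adv t j).message) (fun j => adv t j i)

theorem kingRun_succ_of_round (t : ℕ) (ht : t ≤ 3 * f)
    (h : ∀ i, (kingRun s F x adv t i).round = t) (i : Fin n) :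
    kingRun s F x adv (t + 1) i
      = (kingRun s F x adv t i).step f s (kingInbox s F x adv t i) := by
  have hout : ∀ j, ¬ ((kingProtocol n f s).output j
      ((kingProtocol n f s).run F x adv t j)).isSome = true := by
    intro j
    have hj : ((kingProtocol n f s).run F x adv t j : KingState).round = t := h j
    have : ¬ 3 * f + 1 ≤ ((kingProtocol n f s).run F x adv t j : KingState).round := by omega
    simp [kingProtocol] at this ⊢
    exact this
  unfold kingRun
  rw [SyncProtocol.run, SyncProtocol.next, if_neg (hout i)]
  have hin : (fun j => if j ∈ F then adv t j i else (kingProtocol n f s).emit j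
      ((kingProtocol n f s).run F x adv t j) i) = kingInbox s F x adv t i := by
    funext j
    rw [SyncProtocol.emit, if_neg (hout j)]
    rfl
  rw [hin]
  rfl

theorem kingRun_round (t : ℕ) (ht : t ≤ 3 * f + 1) (i : Fin n) :
    (kingRun s F x adv t i).round = t := by
  induction t generalizing i with
  | zero => rfl
  | succ t ih =>
    rw [kingRun_succ_of_round s F x adv t (by omega) (fun j => ih (by omega) j) i]
    exact congrArg (· + 1) (ih (by omega) i)

theorem kingRun_succ (t : ℕ) (ht : t ≤ 3 * f) (i : Fin n) :
    kingRun s F x adv (t + 1) i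
      = (kingRun s F x adv t i).step f s (kingInbox s F x adv t i) :=
  kingRun_succ_of_round s F x adv t ht (kingRun_round s F x adv t (by omega)) i

theorem kingInbox_eq (t : ℕ) (ht : t ≤ 3 * f) (i : Fin n) :
    kingInbox s F x adv t i = mixed F
      (fun j => if t % 3 = 2 then (kingRun s F x adv t j).prop
        else some (kingRun s F x adv t j).val) (fun j => adv t j i) := by
  unfold kingInbox KingState.message
  simp only [kingRun_round s F x adv t (by omega)]

theorem kingRun_decides {i : Fin n} {a : ℝ} :
    (kingProtocol n f s).Decides F x adv i a ↔ a = (kingRun s F x adv (3 * f + 1) i).val := by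
  have h : (kingProtocol n f s).Decides F x adv i (kingRun s F x adv (3 * f + 1) i).val :=
    ⟨3 * f + 1, if_pos (kingRun_round s F x adv _ le_rfl i).ge⟩
  exact ⟨fun ha => ha.unique h, fun ha => ha ▸ h⟩

variable {s F x adv}

theorem kingRun_leader_val {k : ℕ} (hk : k ≤ f) (i : Fin n) :
    (kingRun s F x adv (3 * k + 1) i).val =
      open Classical in
      if (kingRun s F x adv (3 * k) i).sure then (kingRun s F x adv (3 * k) i).val
      else (kingInbox s F x adv (3 * k) i (leader s k)).getD 0 := by
  rw [kingRun_succ s F x adv _ (by omega) i]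
  simp [KingState.step, kingRun_round s F x adv (3 * k) (by omega)]

theorem kingRun_vote {k : ℕ} (hk : k < f) (i : Fin n) :
    (kingRun s F x adv (3 * k + 2) i).val = (kingRun s F x adv (3 * k + 1) i).val ∧
    (kingRun s F x adv (3 * k + 2) i).prop
      = popular (mixed F (fun j => some (kingRun s F x adv (3 * k + 1) j).val)
          (fun j => adv (3 * k + 1) j i)) (n - f) := by
  rw [kingRun_succ s F x adv (3 * k + 1) (by omega) i, kingInbox_eq s F x adv _ (by omega)]
  have h1 : (3 * k + 1) % 3 = 1 := by omega
  simp [KingState.step, kingRun_round s F x adv (3 * k + 1) (by omega), h1]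

theorem kingRun_propose {k : ℕ} (hk : k < f) (i : Fin n) :
    let inbox := mixed F (fun j => (kingRun s F x adv (3 * k + 2) j).prop)
      (fun j => adv (3 * k + 2) j i)
    (kingRun s F x adv (3 * (k + 1)) i).val
      = (popular inbox (f + 1)).getD (kingRun s F x adv (3 * k + 2) i).val ∧
    ((kingRun s F x adv (3 * (k + 1)) i).sure
      ↔ n - f ≤ votes inbox (kingRun s F x adv (3 * (k + 1)) i).val) := by
  have h1 : (3 * k + 2) % 3 = 2 := by omega
  rw [show 3 * (k + 1) = 3 * k + 2 + 1 by ring,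
    kingRun_succ s F x adv (3 * k + 2) (by omega) i, kingInbox_eq s F x adv _ (by omega)]
  simp [KingState.step, kingRun_round s F x adv (3 * k + 2) (by omega), h1]

/-- Two non-faulty processes never propose different values. -/
theorem kingRun_prop_eq (hn : 3 * f + 1 ≤ n) (hF : F.card ≤ f) {k : ℕ} (hk : k < f)
    {i j : Fin n} {y z : ℝ} (hy : (kingRun s F x adv (3 * k + 2) i).prop = some y)
    (hz : (kingRun s F x adv (3 * k + 2) j).prop = some z) : y = z := by
  rw [(kingRun_vote hk _).2] at hy hz
  exact eq_of_le_votes hn hF (le_votes_of_popular hy) (le_votes_of_popular hz)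

/-- If a non-faulty process is sure of its value before a leader round, then all the non-faulty
processes have this value. -/
theorem kingRun_val_eq_of_sure (hn : 3 * f + 1 ≤ n) (hF : F.card ≤ f) {k : ℕ} (hk : k ≤ f)
    {i : Fin n} (hs : (kingRun s F x adv (3 * k) i).sure) (j : Fin n) :
    (kingRun s F x adv (3 * k) j).val = (kingRun s F x adv (3 * k) i).val := by
  cases k with
  | zero => exact hs.elim
  | succ k =>
    have hi := (kingRun_propose (by omega) i).2.1 hs
    have hj := lt_votes_of_le_votes hn hF hi (fun l => adv (3 * k + 2) l j)
    obtain ⟨z, hz⟩ := exists_popular (Nat.succ_le_of_lt hj)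
    rw [(kingRun_propose (by omega) j).1, hz, Option.getD_some]
    obtain ⟨l, -, hl⟩ := exists_sender_of_lt_votes hF (le_votes_of_popular hz)
    obtain ⟨l', -, hl'⟩ := exists_sender_of_lt_votes hF hj
    exact kingRun_prop_eq hn hF (by omega) hl hl'

/-- A round with a non-faulty leader makes all the non-faulty processes agree. -/
theorem kingRun_val_of_leader (hn : 3 * f + 1 ≤ n) (hF : F.card ≤ f) {k : ℕ} (hk : k ≤ f)
    (hl : leader s k ∉ F) (i : Fin n) :
    (kingRun s F x adv (3 * k + 1) i).val = (kingRun s F x adv (3 * k) (leader s k)).val := by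
  rw [kingRun_leader_val hk]
  split_ifs with hs
  · exact (kingRun_val_eq_of_sure hn hF hk hs _).symm
  · rw [kingInbox_eq s F x adv _ (by omega)]
    refine (congrArg (Option.getD · 0) (mixed_of_notMem hl _ _)).trans ?_
    rw [if_neg (by omega), Option.getD_some]

/-- Once the non-faulty processes agree after a leader round, they agree for good, even if the later
leaders are faulty. -/
theorem kingRun_val_persists (hn : 3 * f + 1 ≤ n) (hF : F.card ≤ f) {k l : ℕ} (hkl : k ≤ l)
    (hl : l ≤ f) {v : ℝ} (hv : ∀ i ∉ F, (kingRun s F x adv (3 * k + 1) i).val = v) :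
    ∀ i ∉ F, (kingRun s F x adv (3 * l + 1) i).val = v := by
  induction l, hkl using Nat.le_induction with
  | base => exact hv
  | succ l _ ih =>
    specialize ih (by omega)
    have hprop : ∀ i ∉ F, (kingRun s F x adv (3 * l + 2) i).prop = some v := by
      intro i _
      have hvotes := le_votes_of_unanimous hF
        (m := fun j => some (kingRun s F x adv (3 * l + 1) j).val)
        (fun j hj => congrArg some (ih j hj)) (fun j => adv (3 * l + 1) j i)
      obtain ⟨z, hz⟩ := exists_popular hvotes
      rw [(kingRun_vote (by omega) i).2, hz,
        eq_of_le_votes hn hF (le_votes_of_popular hz) hvotes]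
    intro i hi
    have hvotes := le_votes_of_unanimous hF hprop (fun j => adv (3 * l + 2) j i)
    obtain ⟨z, hz⟩ := exists_popular (show f + 1 ≤ _ by exact le_trans (by omega) hvotes)
    obtain ⟨j, hj, hjz⟩ := exists_sender_of_lt_votes hF (le_votes_of_popular hz)
    have hzv : z = v := Option.some.inj (hjz.symm.trans (hprop j hj))
    have hval : (kingRun s F x adv (3 * (l + 1)) i).val = v := by
      rw [(kingRun_propose (by omega) i).1, hz, hzv, Option.getD_some]
    rw [kingRun_leader_val hl, if_pos, hval]
    rw [(kingRun_propose (by omega) i).2, hval]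
    exact hvotes

end Execution

theorem kingProtocol_isByzantineBroadcast (hn : 3 * f + 1 ≤ n) (s : Fin n) :
    IsByzantineBroadcast (kingProtocol n f s) s f where
  agreement F hF v adv i hi j hj a b ha hb := by
    rw [kingRun_decides] at ha hb
    obtain ⟨k, hk, hl⟩ := exists_leader_notMem (by omega) hF s
    have h := kingRun_val_persists hn hF hk le_rfl
      (fun i _ => kingRun_val_of_leader (x := senderInput s v) (adv := adv) hn hF hk hl i)
    rw [ha, hb, h i hi, h j hj]
  validity F hF v adv hs i hi a ha := by
    rw [kingRun_decides] at ha
    have hl : leader s 0 ∉ F := by rwa [leader_zero]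
    rw [ha, kingRun_val_persists hn hF (Nat.zero_le f) le_rfl
      (fun i _ => kingRun_val_of_leader hn hF (Nat.zero_le f) hl i) i hi, leader_zero]
    simp [kingRun, SyncProtocol.run, kingProtocol, senderInput]
  termination F hF v adv i hi := ⟨_, (kingRun_decides s F _ adv).2 rfl⟩

end King

/-! ### Broadcasts in parallel -/

section Simulation

variable {n d : ℕ} (B : Fin n → SyncProtocol n (Option ℝ) ℝ) (pick : Multiset (Pt d) → Pt d)

/-- What the faulty processes do to the broadcast of the `k`-th coordinate by `s`. -/
def broadcastAdversary (adv : (bvcAlgorithm B pick).Adversary) (s : Fin n) (k : Fin d) :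
    (B s).Adversary :=
  fun t j i => (adv t j i).bind fun m => m s k

theorem isSome_output_of_bvcAlgorithm {i : Fin n} {σ : (s : Fin n) → Fin d → (B s).State}
    (h : ((bvcAlgorithm B pick).output i σ).isSome) (s : Fin n) (k : Fin d) :
    ((B s).output i (σ s k)).isSome := by
  by_contra hc
  have : ¬ ∀ s k, ((B s).output i (σ s k)).isSome := fun H => hc (H s k)
  simp [collected, this] at h

/-- Each broadcast inside the algorithm runs as it would run alone. A process that has decided falls
silent in all the broadcasts at once, but by then it has terminated in each of them. -/
theorem bvcAlgorithm_run (F : Finset (Fin n)) (x : Fin n → Pt d)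
    (adv : (bvcAlgorithm B pick).Adversary) (t : ℕ) (i s : Fin n) (k : Fin d) :
    (bvcAlgorithm B pick).run F x adv t i s k
      = (B s).run F (senderInput s (x s k)) (broadcastAdversary B pick adv s k) t i := by
  induction t generalizing i with
  | zero =>
    change (B s).init i (senderInput s (x i k) i) = (B s).init i (senderInput s (x s k) i)
    unfold senderInput
    split_ifs with h
    · rw [h]
    · rfl
  | succ t ih =>
    rw [SyncProtocol.run, SyncProtocol.run, ← ih, SyncProtocol.next]
    split_ifs with h
    · rw [SyncProtocol.next, if_pos (isSome_output_of_bvcAlgorithm B pick h s k)]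
    · change (B s).next i _ _ = _
      congr 1
      funext j
      by_cases hj : j ∈ F
      · simp only [if_pos hj]
        rfl
      · simp only [if_neg hj]
        rw [← ih]
        by_cases hh : ((bvcAlgorithm B pick).output j
            ((bvcAlgorithm B pick).run F x adv t j)).isSome
        · rw [SyncProtocol.emit, if_pos hh, SyncProtocol.emit, if_pos (isSome_output_of_bvcAlgorithm B pick hh s k)]
          rfl
        · rw [SyncProtocol.emit, if_neg hh]
          rfl

variable {f : ℕ}

theorem bvcAlgorithm_collects (hn : f < n) (hB : ∀ s, IsByzantineBroadcast (B s) s f)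
    (F : Finset (Fin n)) (hF : F.card ≤ f) (x : Fin n → Pt d)
    (adv : (bvcAlgorithm B pick).Adversary) :
    ∃ S : Fin n → Pt d, (∀ i ∉ F, S i = x i) ∧
      ∀ i ∉ F, ∃ t, collected B i ((bvcAlgorithm B pick).run F x adv t i) = some S := by
  obtain ⟨i₀, hi₀⟩ : ∃ i, i ∉ F := by
    by_contra! h
    have := Finset.card_le_card (show Finset.univ ⊆ F from fun i _ => h i)
    rw [Finset.card_univ, Fintype.card_fin] at this
    omega
  choose a ha using fun s k => (hB s).termination F hF (x s k)
    (broadcastAdversary B pick adv s k) i₀ hi₀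
  refine ⟨fun s => WithLp.toLp 2 (a s), fun s hs => ?_, fun i hi => ?_⟩
  · ext k
    exact (hB s).validity F hF _ _ hs i₀ hi₀ _ (ha s k)
  · have hdec : ∀ s k, ∃ t, (B s).output i ((B s).run F (senderInput s (x s k))
        (broadcastAdversary B pick adv s k) t i) = some (a s k) := by
      intro s k
      obtain ⟨b, hb⟩ := (hB s).termination F hF (x s k)
        (broadcastAdversary B pick adv s k) i hi
      rwa [(hB s).agreement F hF _ _ i hi i₀ hi₀ b _ hb (ha s k)] at hb
    choose t ht using hdec
    let T := Finset.univ.sup fun s => Finset.univ.sup (t s)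
    have hT : ∀ s k, (B s).output i ((bvcAlgorithm B pick).run F x adv T i s k)
        = some (a s k) := by
      intro s k
      have hle : t s k ≤ T := (Finset.le_sup (f := t s) (Finset.mem_univ k)).trans
        (Finset.le_sup (f := fun s => Finset.univ.sup (t s)) (Finset.mem_univ s))
      rw [bvcAlgorithm_run, SyncProtocol.run_of_terminated _ _ _ _ (by rw [ht]; rfl) hle, ht]
    refine ⟨T, ?_⟩
    have hall : ∀ s k, ((B s).output i ((bvcAlgorithm B pick).run F x adv T i s k)).isSome :=
      fun s k => by rw [hT]; rfl
    rw [collected, dif_pos hall]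
    simp only [hT, Option.get_some]

theorem bvcAlgorithm_execution (hn : f < n) (hB : ∀ s, IsByzantineBroadcast (B s) s f)
    (hpick : ∀ Y : Multiset (Pt d), Y.card = n → pick Y ∈ Gam f Y)
    (F : Finset (Fin n)) (hF : F.card ≤ f) (x : Fin n → Pt d)
    (adv : (bvcAlgorithm B pick).Adversary) :
    ∃ S : Fin n → Pt d,
      (∀ i ∉ F, S i = x i) ∧
      (∀ i ∉ F, ∃ t, collected B i ((bvcAlgorithm B pick).run F x adv t i) = some S) ∧
      (∀ i ∉ F, (bvcAlgorithm B pick).Decides F x adv i (pick (pointMultiset S))) ∧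
      pick (pointMultiset S) ∈ Gam f (pointMultiset S) ∧
      Gam f (pointMultiset S) ⊆ convexHull ℝ (x '' {j | j ∉ F}) := by
  obtain ⟨S, hSx, hS⟩ := bvcAlgorithm_collects B pick hn hB F hF x adv
  refine ⟨S, hSx, hS, fun i hi => ?_, hpick _ (by simp [pointMultiset]),
    Gam_pointMultiset_subset F hF S x hSx⟩
  obtain ⟨t, ht⟩ := hS i hi
  exact ⟨t, congrArg (Option.map fun S => pick (pointMultiset S)) ht⟩

theorem bvcAlgorithm_solvesExactBVC (hn : f < n) (hB : ∀ s, IsByzantineBroadcast (B s) s f)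
    (hpick : ∀ Y : Multiset (Pt d), Y.card = n → pick Y ∈ Gam f Y) :
    SolvesExactBVC (bvcAlgorithm B pick) f where
  agreement F hF x adv i hi j hj u v hu hv := by
    obtain ⟨S, -, -, hdec, -⟩ := bvcAlgorithm_execution B pick hn hB hpick F hF x adv
    exact (hu.unique (hdec i hi)).trans ((hdec j hj).unique hv)
  validity F hF x adv i hi v hv := by
    obtain ⟨S, -, -, hdec, hmem, hsub⟩ := bvcAlgorithm_execution B pick hn hB hpick F hF x adv
    exact hv.unique (hdec i hi) ▸ hsub hmem
  termination F hF x adv i hi := by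
    obtain ⟨S, -, -, hdec, -⟩ := bvcAlgorithm_execution B pick hn hB hpick F hF x adv
    exact ⟨_, hdec i hi⟩

end Simulation


theorem theorem2 (n d f : ℕ) (hn : max (3 * f + 1) ((d + 1) * f + 1) ≤ n) :
    -- exact Byzantine vector consensus is solvable
    (∃ P : SyncProtocol n (Pt d) (Pt d), SolvesExactBVC P f) ∧
    -- the algorithm has the broadcast protocols that it needs
    (∃ B : Fin n → SyncProtocol n (Option ℝ) ℝ, ∀ s, IsByzantineBroadcast (B s) s f) ∧
    -- there is a deterministic choice function for it
    (∃ pick : Multiset (Pt d) → Pt d, ∀ Y : Multiset (Pt d), Y.card = n → pick Y ∈ Gam f Y) ∧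
    -- with all such broadcast protocols and choice functions, it is correct
    (∀ (B : Fin n → SyncProtocol n (Option ℝ) ℝ) (pick : Multiset (Pt d) → Pt d),
      (∀ s, IsByzantineBroadcast (B s) s f) →
      (∀ Y : Multiset (Pt d), Y.card = n → pick Y ∈ Gam f Y) →
      SolvesExactBVC (bvcAlgorithm B pick) f ∧
      ∀ (F : Finset (Fin n)), F.card ≤ f →
        ∀ (x : Fin n → Pt d) (adv : (bvcAlgorithm B pick).Adversary),
        ∃ S : Fin n → Pt d,
          (∀ i ∉ F, S i = x i) ∧
          (∀ i ∉ F, ∃ t, collected B i ((bvcAlgorithm B pick).run F x adv t i) = some S) ∧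
          (∀ i ∉ F, (bvcAlgorithm B pick).Decides F x adv i (pick (pointMultiset S))) ∧
          (Gam f (pointMultiset S)).Nonempty ∧
          Gam f (pointMultiset S) ⊆ convexHull ℝ (x '' {j | j ∉ F})) := by
  have h3 : 3 * f + 1 ≤ n := (le_max_left _ _).trans hn
  have hd : (d + 1) * f + 1 ≤ n := (le_max_right _ _).trans hn
  have hB := kingProtocol_isByzantineBroadcast h3
  classical
  have hpick : ∃ pick : Multiset (Pt d) → Pt d,
      ∀ Y : Multiset (Pt d), Y.card = n → pick Y ∈ Gam f Y :=
    ⟨fun Y => if h : (Gam f Y).Nonempty then h.some else 0, fun Y hY => by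
      have h : (Gam f Y).Nonempty := Gam_nonempty Y (hd.trans hY.ge)
      simpa only [dif_pos h] using h.some_mem⟩
  refine ⟨?_, ⟨_, hB⟩, hpick, fun B pick hB' hpick' => ⟨?_, fun F hF x adv => ?_⟩⟩
  · obtain ⟨pick, hp⟩ := hpick
    exact ⟨_, bvcAlgorithm_solvesExactBVC _ pick (by omega) hB hp⟩
  · exact bvcAlgorithm_solvesExactBVC B pick (by omega) hB' hpick'
  · obtain ⟨S, h1, h2, h4, h5, h6⟩ :=
      bvcAlgorithm_execution B pick (by omega) hB' hpick' F hF x adv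
    exact ⟨S, h1, h2, h4, ⟨_, h5⟩, h6⟩
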